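/- All graphs are finite and simple, $\log=\log_2$, and $H(p)=-p\log p-(1-p)\log(1-p)$ is the binary entropy function (with $0\log 0=0$); $\Phi_\ell(G)$ denotes the number of matchings of size $\ell$ (sets of $\ell$ pairwise disjoint edges) of a graph $G$. For integers $d\ge 1$, $N\ge 0$ and $0\le \ell\le N/2$ put $\alpha=2\ell/N$ (and $\alpha=0$ if $N=0$) and $$B(d,N,\ell)=\frac N2\left[\alpha\log d+2H(\alpha)+\alpha\log\frac{\alpha}{e}+\frac{\log d}{d-1}\right],$$ where $\frac{\log d}{d-1}$ is read as $\log e$ for $d=1$ and $\alpha\log\frac{\alpha}{e}$ as $0$ for $\alpha=0$. (1) If $d\ge 1$, $G$ is a $d$-regular graph with $N$ vertices and $0\le\ell\le N/2$, then $$\log\Phi_\ell(G)\le B(d,N,\ell),$$ with the convention $\log 0=-\infty$ (that is, nothing is claimed if $\Phi_\ell(G)=0$). (2) This matches the bound of the Upper Matching Conjecture up to a factor $\exp[o_d(1)N]$: there is a function $\varepsilon:\mathbb N\to\mathbb R$ with $\varepsilon(d)\to 0$ as $d\to\infty$ such that for all $d\ge1$, all $N$ divisible by $2d$ and all $0\le\ell\le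 N/2$, $$2^{B(d,N,\ell)}\le e^{\varepsilon(d)N}\,\Phi_\ell\!\left(\tfrac{N}{2d}K_{d,d}\right),$$ where $tK_{d,d}$ is the disjoint union of $t$ copies of the complete bipartite graph $K_{d,d}$. -/

import Mathlib

namespace UpperMatching

/-- The number `Φ_ℓ(G)` of matchings of size `ℓ` of `G`. A matching is recorded as a subgraph all
of whose vertices have exactly one neighbour in it; its size is its number of edges. -/
noncomputable def numMatchings {V : Type*} (G : SimpleGraph V) (ℓ : ℕ) : ℕ :=
  {M : G.Subgraph | M.IsMatching ∧ M.edgeSet.ncard = ℓ}.ncard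

/-- The binary entropy function in base 2 (with `0 log 0 = 0`, since `Real.logb 2 0 = 0`). -/
noncomputable def H (p : ℝ) : ℝ :=
  -(p * Real.logb 2 p) - (1 - p) * Real.logb 2 (1 - p)

/-- `log₂ d / (d - 1)`, read as `log₂ e` for `d = 1`. -/
noncomputable def logQuot (d : ℕ) : ℝ :=
  if d = 1 then Real.logb 2 (Real.exp 1) else Real.logb 2 d / ((d : ℝ) - 1)

/-- The fraction `α = 2ℓ/N` of the `N` vertices that are covered by a matching of size `ℓ`. -/
noncomputable def coverFraction (N ℓ : ℕ) : ℝ := 2 * (ℓ : ℝ) / (N : ℝ)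

/-- `(N/2) [α log d + 2 H(α) + α log (α/e) + log d / (d-1)]` with `α = 2ℓ/N` and logarithms in
base 2. For `ℓ = 0` the term `α log (α/e)` is zero. -/
noncomputable def matchingBound (d N ℓ : ℕ) : ℝ :=
  (N : ℝ) / 2 *
    (coverFraction N ℓ * Real.logb 2 d + 2 * H (coverFraction N ℓ)
      + coverFraction N ℓ * Real.logb 2 (coverFraction N ℓ / Real.exp 1) + logQuot d)

/-- The disjoint union `t K_{d,d}` of `t` copies of the complete bipartite graph `K_{d,d}`. -/
def copiesKdd (t d : ℕ) : SimpleGraph (Fin t × (Fin d ⊕ Fin d)) where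
  Adj u v := u.1 = v.1 ∧ (completeBipartiteGraph (Fin d) (Fin d)).Adj u.2 v.2
  symm := ⟨fun _ _ h => ⟨h.1.symm, h.2.symm⟩⟩
  loopless := ⟨fun _ h => h.2.ne rfl⟩

end UpperMatching

/-!
The upper bound is proved for bipartite graphs and transferred to all graphs.

In the bipartite double cover of `G`, whose two sides are copies of the vertex set, a partial
matching is a set of arcs of `G` in which every vertex has in- and outdegree at most one. The
union of two matchings `M₁`, `M₂` of `G` is a disjoint union of paths and even cycles, hence has a
proper 2-colouring, which can be chosen to depend on the union only. Directing the edges of `M₁`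
from the first colour to the second and those of `M₂` backwards gives a partial matching of the
double cover from which `(M₁, M₂)` can be recovered, so `Φ_ℓ(G) ^ 2` is at most the number of
partial matchings of size `2 ℓ` of the double cover (`numMatchings_sq_le`).

For a `d`-regular bipartite graph on `n + n` vertices, fix the set `B` of `m = α n` matched
vertices on the right and let `r_v` be the degree of `v` into `B`. By Bregman's theorem
(`log_card_perfMatchings_le`) the matchings between `A` and `B` number at most `∏_{v ∈ A} (r_v!) ^
(1 / r_v)`, and each factor is at most `(r_v + shift d) / e`, where `d + shift d = d * d ^ (1 / (d
- 1))` (`log_factorial_div_le`). The `r_v` have average `α d` over the whole left side, so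
Maclaurin's inequality bounds the sum over all `A` by `2 ^ (n H(α)) ((α d + shift d) / e) ^ m`.
The choice of `B` costs another factor `2 ^ (n H(α))`, which gives `card_partialMatchings_le`;
Bernoulli's inequality turns `shift d` into the error term `log d / (d - 1)`.

For the lower bound, the `ℓ` edges are distributed evenly over the `t` copies of `K_{d,d}`, each
of which has `(d choose k) ^ 2 k!` matchings of size `k`. Stirling's formula compares this number
with the bound up to a factor polynomial in `d` for each copy (`mainTerm_le_log_numMatchingsKdd`).
There is one copy for every `2 d` vertices, so the total loss is `exp (O(log d / d) N)`.
-/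

namespace UpperMatching

open Finset

/-! ### Bregman's theorem for the permanent of a 0-1 matrix -/

section Bregman

variable {α β : Type*}

open Classical in
/-- The perfect matchings between the finite sets `A` and `B` along the relation `R`: sets of pairs
in `R` that project injectively onto `A` and onto `B`. Their number is the permanent of the
0-1 matrix of `R` on `A × B` if `#A = #B`, and zero otherwise. -/
noncomputable def perfMatchings (R : α → β → Prop) [DecidableRel R] (A : Finset α) (B : Finset β) :
    Finset (Finset (α × β)) :=
  {F ∈ (A ×ˢ B).powerset | (∀ p ∈ F, R p.1 p.2) ∧ (∀ a ∈ A, ∃! b, (a, b) ∈ F) ∧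
    ∀ b ∈ B, ∃! a, (a, b) ∈ F}

variable {R : α → β → Prop} [DecidableRel R] {A : Finset α} {B : Finset β}

lemma mem_perfMatchings {F : Finset (α × β)} : F ∈ perfMatchings R A B ↔
    (∀ a b, (a, b) ∈ F → a ∈ A ∧ b ∈ B ∧ R a b) ∧ (∀ a ∈ A, ∃! b, (a, b) ∈ F) ∧
    ∀ b ∈ B, ∃! a, (a, b) ∈ F := by
  simp only [perfMatchings, mem_filter, mem_powerset, subset_iff, Prod.forall, mem_product]
  grind

variable [DecidableEq α] [DecidableEq β]

lemma card_filter_mem_perfMatchings {a : α} {b : β} (ha : a ∈ A) (hb : b ∈ B) (hR : R a b) :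
    #{F ∈ perfMatchings R A B | (a, b) ∈ F} = #(perfMatchings R (A.erase a) (B.erase b)) := by
  refine card_bij' (fun F _ => F.erase (a, b)) (fun F _ => insert (a, b) F) ?_ ?_ ?_ ?_
  · intro F hF
    simp only [mem_filter, mem_perfMatchings] at hF ⊢
    obtain ⟨⟨h1, h2, h3⟩, hab⟩ := hF
    refine ⟨fun x y hxy => ?_, fun x hx => ?_, fun y hy => ?_⟩
    · simp only [mem_erase, ne_eq, Prod.mk.injEq] at hxy ⊢
      have := h1 x y hxy.2
      have := (h2 a ha).unique hab (y₂ := y)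
      have := (h3 b hb).unique hab (y₂ := x)
      grind
    · obtain ⟨y, hy, hu⟩ := h2 x (mem_of_mem_erase hx)
      refine ⟨y, ?_, fun z hz => hu z (mem_of_mem_erase hz)⟩
      simp only [mem_erase] at hx ⊢
      grind
    · obtain ⟨x, hx, hu⟩ := h3 y (mem_of_mem_erase hy)
      refine ⟨x, ?_, fun z hz => hu z (mem_of_mem_erase hz)⟩
      simp only [mem_erase] at hy ⊢
      grind
  · intro F hF
    simp only [mem_filter, mem_perfMatchings] at hF ⊢
    obtain ⟨h1, h2, h3⟩ := hF
    refine ⟨⟨fun x y hxy => ?_, fun x hx => ?_, fun y hy => ?_⟩, mem_insert_self _ _⟩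
    · simp only [mem_insert, Prod.mk.injEq] at hxy
      have := h1 x y
      grind
    · by_cases hxa : x = a
      · refine ⟨b, by simp [hxa], fun z hz => ?_⟩
        have := h1 x z
        grind
      · obtain ⟨y, hy, hu⟩ := h2 x (mem_erase.2 ⟨hxa, hx⟩)
        refine ⟨y, by simp [hy], fun z hz => hu z ?_⟩
        grind
    · by_cases hyb : y = b
      · refine ⟨a, by simp [hyb], fun z hz => ?_⟩
        have := h1 z y
        grind
      · obtain ⟨x, hx, hu⟩ := h3 y (mem_erase.2 ⟨hyb, hy⟩)
        refine ⟨x, by simp [hx], fun z hz => hu z ?_⟩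
        grind
  · intro F hF
    exact insert_erase (mem_filter.1 hF).2
  · intro F hF
    refine erase_insert fun h => ?_
    have := ((mem_perfMatchings.1 hF).1 a b h).1
    simp at this

lemma sum_perfMatchings (a : α) (ha : a ∈ A) (g : β → ℝ) :
    ∑ F ∈ perfMatchings R A B, ∑ b ∈ B with (a, b) ∈ F, g b
      = ∑ b ∈ B with R a b, #(perfMatchings R (A.erase a) (B.erase b)) * g b := by
  simp_rw [sum_filter]
  rw [sum_comm]
  refine sum_congr rfl fun b hb => ?_
  rw [← sum_filter, sum_const, nsmul_eq_mul]
  split_ifs with h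
  · rw [card_filter_mem_perfMatchings ha hb h]
  · rw [filter_false_of_mem]
    · simp
    · intro F hF hab
      exact h ((mem_perfMatchings.1 hF).1 a b hab).2.2

lemma exists_filter_eq_singleton {F : Finset (α × β)} (hF : F ∈ perfMatchings R A B) {a : α}
    (ha : a ∈ A) : ∃ b, (a, b) ∈ F ∧ {b ∈ B | (a, b) ∈ F} = {b} := by
  obtain ⟨h1, h2, -⟩ := mem_perfMatchings.1 hF
  obtain ⟨b, hb, hu⟩ := h2 a ha
  refine ⟨b, hb, ?_⟩
  ext y
  simp only [mem_filter, mem_singleton]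
  exact ⟨fun h => hu y h.2, fun h => h ▸ ⟨(h1 a b hb).2.1, hb⟩⟩

lemma sum_card_perfMatchings_erase (a : α) (ha : a ∈ A) :
    ∑ b ∈ B with R a b, (#(perfMatchings R (A.erase a) (B.erase b)) : ℝ)
      = #(perfMatchings R A B) := by
  have := sum_perfMatchings (R := R) (B := B) a ha (fun _ => 1)
  simp only [mul_one] at this
  rw [← this, card_eq_sum_ones, Nat.cast_sum]
  refine sum_congr rfl fun F hF => ?_
  obtain ⟨b, -, hb⟩ := exists_filter_eq_singleton hF ha
  simp [hb]

/-- Jensen's inequality for `t log t`, for a sum of `#s` terms. -/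
lemma sum_mul_log_sum_le {ι : Type*} (s : Finset ι) (x : ι → ℝ) (hx : ∀ i ∈ s, 0 ≤ x i) :
    (∑ i ∈ s, x i) * Real.log (∑ i ∈ s, x i) ≤
      (∑ i ∈ s, x i) * Real.log #s + ∑ i ∈ s, x i * Real.log (x i) := by
  rcases s.eq_empty_or_nonempty with rfl | hs
  · simp
  have hc : (0 : ℝ) < #s := by exact_mod_cast hs.card_pos
  have hJ := Real.convexOn_mul_log.map_sum_le (t := s) (w := fun _ => (#s : ℝ)⁻¹) (p := x)
    (fun _ _ => by positivity) (by simp [hc.ne']) (fun i hi => hx i hi)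
  simp only [smul_eq_mul, ← mul_sum] at hJ
  rcases (sum_nonneg hx).eq_or_lt with h0 | h0
  · rw [← h0] at hJ ⊢
    simp only [mul_zero, zero_mul, zero_add] at hJ ⊢
    exact (mul_nonneg_iff_of_pos_left (inv_pos.2 hc)).1 hJ
  · rw [Real.log_mul (by positivity) h0.ne', Real.log_inv, mul_assoc,
      mul_le_mul_iff_right₀ (inv_pos.2 hc)] at hJ
    linarith

/-- **Bregman's theorem** in logarithmic form: the number of perfect matchings between `A` and `B`
is at most `∏ (r_a!)^(1/r_a)`, where `r_a` is the number of elements of `B` related to `a ∈ A`.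
The proof is Schrijver's: apply Jensen's inequality to the expansion along every row, and rewrite
the resulting sum as a sum over all perfect matchings before using the induction hypothesis. -/
theorem log_card_perfMatchings_le (R : α → β → Prop) [DecidableRel R] (A : Finset α)
    (B : Finset β) (hne : (perfMatchings R A B).Nonempty) :
    Real.log #(perfMatchings R A B) ≤
      ∑ a ∈ A, Real.log (#{b ∈ B | R a b}).factorial / #{b ∈ B | R a b} := by
  induction hn : #A generalizing A B with
  | zero =>
    obtain rfl : A = ∅ := card_eq_zero.1 hn
    have : #(perfMatchings R (∅ : Finset α) B) ≤ 1 := by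
      refine card_le_one.2 fun F hF G hG => ?_
      have key : ∀ F ∈ perfMatchings R (∅ : Finset α) B, F = ∅ := fun F hF =>
        eq_empty_of_forall_notMem fun p hp => by
          simpa using ((mem_perfMatchings.1 hF).1 p.1 p.2 hp).1
      rw [key F hF, key G hG]
    have h1 : #(perfMatchings R (∅ : Finset α) B) = 1 := le_antisymm this hne.card_pos
    simp [h1]
  | succ n ih =>
    set w : ℕ → ℝ := fun r => Real.log r.factorial / r with hw
    set r : α → ℕ := fun a => #{b ∈ B | R a b} with hr
    set P : ℝ := (#(perfMatchings R A B) : ℝ) with hP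
    have hPpos : 0 < P := by rw [hP]; exact_mod_cast hne.card_pos
    set Q : α → β → ℝ := fun a b => (#(perfMatchings R (A.erase a) (B.erase b)) : ℝ) with hQ
    have hcardB : ∀ F ∈ perfMatchings R A B, #B = n + 1 := by
      intro F hF
      obtain ⟨h1, h2, h3⟩ := mem_perfMatchings.1 hF
      have e1 : #F = #A := card_bij (fun p _ => p.1) (fun p hp => (h1 p.1 p.2 hp).1)
        (fun p hp q hq h => by
          have := (h2 p.1 (h1 p.1 p.2 hp).1).unique hp (y₂ := q.2) (by rw [h]; exact hq)
          exact Prod.ext h this)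
        (fun a ha => by obtain ⟨b, hb, -⟩ := h2 a ha; exact ⟨(a, b), hb, rfl⟩)
      have e2 : #F = #B := card_bij (fun p _ => p.2) (fun p hp => (h1 p.1 p.2 hp).2.1)
        (fun p hp q hq h => by
          have := (h3 p.2 (h1 p.1 p.2 hp).2.1).unique hp (y₂ := q.1) (by rw [h]; exact hq)
          exact Prod.ext this h)
        (fun b hb => by obtain ⟨a, ha, -⟩ := h3 b hb; exact ⟨(a, b), ha, rfl⟩)
      omega
    -- Jensen's inequality along the row `a`
    have hrow : ∀ a ∈ A, P * Real.log P ≤ P * Real.log (r a) +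
        ∑ F ∈ perfMatchings R A B, ∑ b ∈ B with (a, b) ∈ F, Real.log (Q a b) := by
      intro a ha
      have := sum_mul_log_sum_le (B.filter fun b => R a b) (Q a) (fun _ _ => Nat.cast_nonneg _)
      rw [sum_card_perfMatchings_erase a ha] at this
      rwa [sum_perfMatchings a ha]
    -- the induction hypothesis, summed over the pairs of one perfect matching
    have hF : ∀ F ∈ perfMatchings R A B,
        ∑ a ∈ A, (Real.log (r a) + ∑ b ∈ B with (a, b) ∈ F, Real.log (Q a b)) ≤
          ∑ a ∈ A, (n + 1) * w (r a) := by
      intro F hF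
      obtain ⟨h1, h2, h3⟩ := mem_perfMatchings.1 hF
      have hB := hcardB F hF
      have : Nonempty β := ⟨(card_pos.1 (by omega : 0 < #B)).choose⟩
      choose! ν hνF hν using fun a (ha : a ∈ A) => exists_filter_eq_singleton hF ha
      have hνB : ∀ a ∈ A, ν a ∈ B ∧ R a (ν a) := fun a ha => (h1 a _ (hνF a ha)).2
      have hind : ∀ a ∈ A, Real.log (Q a (ν a)) ≤
          ∑ c ∈ A.erase a, w (if R c (ν a) then r c - 1 else r c) := by
        intro a ha
        have := ih (A.erase a) (B.erase (ν a)) (by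
          rw [← card_pos, ← card_filter_mem_perfMatchings ha (hνB a ha).1 (hνB a ha).2, card_pos]
          exact ⟨F, mem_filter.2 ⟨hF, hνF a ha⟩⟩) (by rw [card_erase_of_mem ha]; omega)
        refine this.trans (sum_le_sum fun c _ => le_of_eq ?_)
        rw [filter_erase]
        split_ifs with hc
        · rw [card_erase_of_mem (mem_filter.2 ⟨(hνB a ha).1, hc⟩)]
        · rw [erase_eq_of_notMem (by simp [hc])]
      have hinj : Set.InjOn ν A := fun a ha c hc h =>
        (h3 (ν a) (hνB a ha).1).unique (hνF a ha) (h ▸ hνF c hc)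
      have himg : A.image ν = B := eq_of_subset_of_card_le
        (image_subset_iff.2 fun a ha => (hνB a ha).1) (by rw [card_image_of_injOn hinj]; omega)
      -- the column sums
      have hcol : ∀ c ∈ A, ∑ a ∈ A.erase c, w (if R c (ν a) then r c - 1 else r c) =
          (r c - 1 : ℝ) * w (r c - 1) + (n + 1 - r c) * w (r c) := by
        intro c hc
        have e1 : ∑ a ∈ A, w (if R c (ν a) then r c - 1 else r c) =
            ∑ b ∈ B, w (if R c b then r c - 1 else r c) := by
          rw [← himg, sum_image hinj]
        have e2 : ∑ b ∈ B, w (if R c b then r c - 1 else r c) =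
            r c * w (r c - 1) + (n + 1 - r c) * w (r c) := by
          rw [← sum_filter_add_sum_filter_not B (fun b => R c b)]
          have hle : r c ≤ n + 1 := hB ▸ card_filter_le _ _
          have hnot : #{b ∈ B | ¬ R c b} = n + 1 - r c := by
            have := card_filter_add_card_filter_not (s := B) (fun b => R c b)
            simp only [hr]; omega
          congr 1
          · rw [sum_congr rfl (g := fun _ => w (r c - 1))
              (fun b hb => by rw [if_pos (mem_filter.1 hb).2]), sum_const, nsmul_eq_mul]
          · rw [sum_congr rfl (g := fun _ => w (r c))
              (fun b hb => by rw [if_neg (mem_filter.1 hb).2]), sum_const, nsmul_eq_mul, hnot,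
              Nat.cast_sub hle]
            push_cast; rfl
        have e3 := add_sum_erase A (fun a => w (if R c (ν a) then r c - 1 else r c)) hc
        simp only [if_pos (hνB c hc).2] at e3
        linarith
      calc ∑ a ∈ A, (Real.log (r a) + ∑ b ∈ B with (a, b) ∈ F, Real.log (Q a b))
          = ∑ a ∈ A, (Real.log (r a) + Real.log (Q a (ν a))) :=
            sum_congr rfl fun a ha => by rw [hν a ha, sum_singleton]
        _ ≤ ∑ a ∈ A, (Real.log (r a) +
              ∑ c ∈ A.erase a, w (if R c (ν a) then r c - 1 else r c)) :=
            sum_le_sum fun a ha => by have := hind a ha; linarith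
        _ = ∑ c ∈ A, (Real.log (r c) +
              ∑ a ∈ A.erase c, w (if R c (ν a) then r c - 1 else r c)) := by
            rw [sum_add_distrib, sum_add_distrib]
            congr 1
            refine sum_comm' ?_
            intro x y
            simp only [mem_erase]
            tauto
        _ = ∑ a ∈ A, (n + 1) * w (r a) := by
            refine sum_congr rfl fun c hc => ?_
            rw [hcol c hc]
            have hpos : 0 < r c := card_pos.2 ⟨ν c, mem_filter.2 (hνB c hc)⟩
            obtain ⟨q, hq⟩ : ∃ q, r c = q + 1 := ⟨r c - 1, by omega⟩
            have hfac : Real.log (q + 1).factorial =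
                Real.log ((q + 1 : ℕ) : ℝ) + Real.log q.factorial := by
              rw [Nat.factorial_succ, Nat.cast_mul, Real.log_mul (by positivity) (by positivity)]
            have hq0 : (q : ℝ) * w q = Real.log q.factorial := by
              rcases Nat.eq_zero_or_pos q with rfl | hq'
              · simp
              · simp only [hw]; field_simp
            have hq1 : ((q + 1 : ℕ) : ℝ) * w (q + 1) = Real.log (q + 1).factorial := by
              simp only [hw]; field_simp
            rw [hq, Nat.add_sub_cancel]
            push_cast at *
            linear_combination hq0 - hfac - hq1
    have hsum : (n + 1) * (P * Real.log P) ≤ P * ∑ a ∈ A, (n + 1) * w (r a) := by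
      calc (n + 1) * (P * Real.log P) = ∑ a ∈ A, P * Real.log P := by
            rw [sum_const, hn, nsmul_eq_mul]; push_cast; ring
        _ ≤ ∑ a ∈ A, (P * Real.log (r a) +
              ∑ F ∈ perfMatchings R A B, ∑ b ∈ B with (a, b) ∈ F, Real.log (Q a b)) :=
            sum_le_sum hrow
        _ = ∑ F ∈ perfMatchings R A B,
              ∑ a ∈ A, (Real.log (r a) + ∑ b ∈ B with (a, b) ∈ F, Real.log (Q a b)) := by
            rw [sum_comm, sum_congr rfl fun a _ => ?_]
            rw [sum_add_distrib, sum_const, nsmul_eq_mul]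
        _ ≤ ∑ F ∈ perfMatchings R A B, ∑ a ∈ A, (n + 1) * w (r a) := sum_le_sum hF
        _ = P * ∑ a ∈ A, (n + 1) * w (r a) := by rw [sum_const, nsmul_eq_mul]
    rw [← mul_sum] at hsum
    have hpos : (0 : ℝ) < (n + 1) * P := by positivity
    refine le_of_mul_le_mul_left ?_ hpos
    linarith

end Bregman

/-! ### Factorials, power means and entropy -/

section Analysis

/-- The natural logarithm counterpart of `logQuot`: it is `log d / (d - 1)`, read as `1` for
`d = 1`. -/
noncomputable def lnQuot (d : ℕ) : ℝ := if d = 1 then 1 else Real.log d / ((d : ℝ) - 1)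

/-- The number `d (d ^ (1 / (d - 1)) - 1)`, read as `e - 1` for `d = 1`. It is chosen such that
`d + shift d = d * d ^ (1 / (d - 1))`, and `(r + shift d) / e` serves as an upper bound, affine
in `r`, for `(r!) ^ (1 / r)` in the range `1 ≤ r ≤ d`. -/
noncomputable def shift (d : ℕ) : ℝ := d * (Real.exp (lnQuot d) - 1)

lemma lnQuot_nonneg (d : ℕ) : 0 ≤ lnQuot d := by
  unfold lnQuot
  split_ifs with h
  · exact zero_le_one
  · rcases Nat.eq_zero_or_pos d with rfl | hd
    · simp
    · have : (1 : ℝ) ≤ d := by exact_mod_cast hd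
      exact div_nonneg (Real.log_nonneg this) (by linarith)

lemma shift_nonneg (d : ℕ) : 0 ≤ shift d :=
  mul_nonneg (Nat.cast_nonneg _) (sub_nonneg.2 (Real.one_le_exp (lnQuot_nonneg d)))

lemma log_factorial_le (r : ℕ) (hr : 1 ≤ r) :
    Real.log r.factorial ≤ r * Real.log r - r + 1 + Real.log r / 2 := by
  have hr0 : (0 : ℝ) < r := by exact_mod_cast hr
  have h := Stirling.log_stirlingSeq'_antitone (Nat.zero_le (r - 1))
  simp only [Function.comp, Nat.succ_eq_add_one, Nat.sub_add_cancel hr, zero_add] at h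
  rw [Stirling.log_stirlingSeq_formula, Stirling.log_stirlingSeq_formula,
    Real.log_div hr0.ne' (Real.exp_pos 1).ne', Real.log_mul (by norm_num) hr0.ne'] at h
  simp only [Nat.factorial_one, Nat.cast_one, Real.log_one, mul_one, one_div,
    Real.log_inv, Real.log_exp] at h
  linarith

/-- The inequality `log t ≤ √t - 1 / √t`, multiplied by `√t` and squared. -/
lemma mul_log_sq_le (t : ℝ) (ht : 1 ≤ t) : t * Real.log t ^ 2 ≤ (t - 1) ^ 2 := by
  have ht0 : 0 < t := by linarith
  have hlog := Real.log_nonneg ht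
  have h := Real.self_le_sinh_iff.2 (show 0 ≤ Real.log t / 2 by linarith)
  rw [Real.sinh_eq] at h
  have h2 : Real.log t ≤ Real.exp (Real.log t / 2) - Real.exp (-(Real.log t / 2)) := by linarith
  have hsq : Real.exp (Real.log t / 2) ^ 2 = t := by
    rw [← Real.exp_nat_mul]; push_cast; rw [mul_div_cancel₀ _ two_ne_zero, Real.exp_log ht0]
  have hinv : Real.exp (Real.log t / 2) * Real.exp (-(Real.log t / 2)) = 1 := by
    rw [← Real.exp_add]; simp
  set y := Real.exp (Real.log t / 2)
  set z := Real.exp (-(Real.log t / 2))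
  have h3 : y * Real.log t ≤ t - 1 := by
    have := mul_le_mul_of_nonneg_left h2 (Real.exp_pos (Real.log t / 2)).le
    change y * _ ≤ y * _ at this
    nlinarith
  calc t * Real.log t ^ 2 = (y * Real.log t) ^ 2 := by rw [mul_pow, hsq]
    _ ≤ (t - 1) ^ 2 := by
      have : 0 ≤ y := (Real.exp_pos _).le
      gcongr

/-- The derivative is nonnegative by `1 + x ≤ exp x` and `mul_log_sq_le`. -/
lemma monotoneOn_shift_aux :
    MonotoneOn (fun t : ℝ => t * (Real.exp (Real.log t / (t - 1)) - 1)) (Set.Ioi 1) := by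
  have hder : ∀ t : ℝ, 1 < t → HasDerivAt (fun t : ℝ => t * (Real.exp (Real.log t / (t - 1)) - 1))
      (1 * (Real.exp (Real.log t / (t - 1)) - 1) + t * (Real.exp (Real.log t / (t - 1)) *
        ((t⁻¹ * (t - 1) - Real.log t * 1) / (t - 1) ^ 2))) t := by
    intro t ht
    have h1 : HasDerivAt (fun t : ℝ => Real.log t / (t - 1))
        ((t⁻¹ * (t - 1) - Real.log t * 1) / (t - 1) ^ 2) t :=
      (Real.hasDerivAt_log (by linarith)).div ((hasDerivAt_id t).sub_const 1) (by simp; linarith)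
    exact (hasDerivAt_id t).mul (h1.exp.sub_const 1)
  refine monotoneOn_of_deriv_nonneg (convex_Ioi 1)
    (fun t ht => (hder t ht).continuousAt.continuousWithinAt)
    (fun t ht => (hder t (interior_subset ht)).differentiableAt.differentiableWithinAt) ?_
  intro t ht
  have ht : 1 < t := interior_subset ht
  rw [(hder t ht).deriv]
  have ht0 : 0 < t := by linarith
  have ht1 : 0 < t - 1 := by linarith
  have hexp := Real.add_one_le_exp (Real.log t / (t - 1))
  have hlog1 := Real.log_le_sub_one_of_pos ht0
  have hsq := mul_log_sq_le t ht.le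
  set E := Real.exp (Real.log t / (t - 1))
  set l := Real.log t
  have e : 1 * (E - 1) + t * (E * ((t⁻¹ * (t - 1) - l * 1) / (t - 1) ^ 2)) =
      E * (t * (t - 1 - l) / (t - 1) ^ 2) - 1 := by
    field_simp
    ring
  rw [e, sub_nonneg]
  calc 1 ≤ (l / (t - 1) + 1) * (t * (t - 1 - l) / (t - 1) ^ 2) := by
        have : (l / (t - 1) + 1) * (t * (t - 1 - l) / (t - 1) ^ 2) =
          t * ((t - 1) ^ 2 - l ^ 2) / (t - 1) ^ 3 := by
          field_simp
          ring
        rw [this, le_div_iff₀ (by positivity)]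
        nlinarith
    _ ≤ E * (t * (t - 1 - l) / (t - 1) ^ 2) := by
        refine mul_le_mul_of_nonneg_right hexp ?_
        have : 0 ≤ t - 1 - l := by linarith
        positivity

lemma shift_eq {d : ℕ} (hd : d ≠ 1) :
    shift d = (d : ℝ) * (Real.exp (Real.log d / ((d : ℝ) - 1)) - 1) := by
  simp [shift, lnQuot, hd]

lemma shift_mono {r d : ℕ} (hr : 1 ≤ r) (hrd : r ≤ d) : shift r ≤ shift d := by
  have key : ∀ {r d : ℕ}, 2 ≤ r → r ≤ d → shift r ≤ shift d := by
    intro r d hr hrd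
    rw [shift_eq (by omega), shift_eq (by omega)]
    exact monotoneOn_shift_aux (Set.mem_Ioi.2 (by exact_mod_cast hr))
      (Set.mem_Ioi.2 (by exact_mod_cast (by omega : 1 < d))) (by exact_mod_cast hrd)
  rcases hr.eq_or_lt with rfl | hr
  · rcases hrd.eq_or_lt with rfl | hrd
    · exact le_rfl
    · refine le_trans ?_ (key le_rfl hrd)
      rw [shift_eq (by norm_num : 2 ≠ 1)]
      have h2 : Real.exp (Real.log 2) = 2 := Real.exp_log (by norm_num)
      have := Real.exp_one_lt_d9
      norm_num [shift, lnQuot, h2]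
      linarith
  · exact key hr hrd

lemma add_shift (d : ℕ) : d + shift d = d * Real.exp (lnQuot d) := by
  unfold shift; ring

/-- The bound `(r!) ^ (1 / r) ≤ (r + shift d) / e`, in logarithmic form. -/
lemma log_factorial_div_le {r d : ℕ} (hr : 1 ≤ r) (hrd : r ≤ d) :
    Real.log r.factorial / r ≤ Real.log (((r : ℝ) + shift d) / Real.exp 1) := by
  have hr0 : (0 : ℝ) < r := by exact_mod_cast hr
  have hs := shift_nonneg r
  have hmono := shift_mono hr hrd
  have h1 : Real.log (((r : ℝ) + shift r) / Real.exp 1) ≤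
      Real.log (((r : ℝ) + shift d) / Real.exp 1) := by gcongr
  refine le_trans ?_ h1
  rw [add_shift, Real.log_div (by positivity) (Real.exp_pos 1).ne',
    Real.log_mul hr0.ne' (Real.exp_pos _).ne', Real.log_exp, Real.log_exp, div_le_iff₀ hr0]
  rcases hr.eq_or_lt with rfl | hr2
  · simp [lnQuot]
  have hS := log_factorial_le r hr
  have hr1 : (1 : ℝ) < r := by exact_mod_cast hr2
  -- the lower bound `2 (r - 1) / (r + 1) ≤ log r`
  have hl := Real.le_log_one_add_of_nonneg (show (0 : ℝ) ≤ r - 1 by linarith)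
  rw [add_sub_cancel, div_le_iff₀ (by linarith)] at hl
  simp only [lnQuot, if_neg (show r ≠ 1 by omega)]
  have hr1' : (0 : ℝ) < r - 1 := by linarith
  have : 1 + Real.log r / 2 ≤ Real.log r / (r - 1) * r := by
    rw [div_mul_eq_mul_div, le_div_iff₀ hr1']
    nlinarith
  linarith

lemma prod_le_average_pow {ι : Type*} [Fintype ι] (z : ι → ℝ) (hz : ∀ i, 0 ≤ z i) (μ : ℝ)
    (hμ : ∑ i, z i = Fintype.card ι * μ) : ∏ i, z i ≤ μ ^ Fintype.card ι := by
  rcases isEmpty_or_nonempty ι with h | h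
  · simp
  have hn : (0 : ℝ) < Fintype.card ι := by exact_mod_cast Fintype.card_pos
  have := Real.geom_mean_le_arith_mean univ (fun _ => 1) z (by simp) (by simpa using hn)
    (fun i _ => hz i)
  simp only [Real.rpow_one, one_mul, sum_const, card_univ, nsmul_eq_mul, mul_one, hμ] at this
  rw [mul_div_cancel_left₀ _ hn.ne'] at this
  have h0 : 0 ≤ ∏ i, z i := prod_nonneg fun i _ => hz i
  have h1 := pow_le_pow_left₀ (Real.rpow_nonneg h0 _) this (Fintype.card ι)
  rwa [← Real.rpow_natCast (_ ^ _), ← Real.rpow_mul h0, inv_mul_cancel₀ hn.ne', Real.rpow_one] at h1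

/-- A form of Maclaurin's inequality, with the binomial coefficient replaced by its entropy bound:
if the `c i` have average `μ`, the sum of the products of `m` of them is at most `exp (n h) μ ^ m`,
where `h` is the entropy of `m / n`. -/
lemma sum_powersetCard_prod_le {ι : Type*} [Fintype ι] (c : ι → ℝ) (hc : ∀ i, 0 ≤ c i) (μ : ℝ)
    (hμ : ∑ i, c i = Fintype.card ι * μ) (m : ℕ) (hm : m ≤ Fintype.card ι) :
    ∑ A ∈ powersetCard m (univ : Finset ι), ∏ i ∈ A, c i ≤
      Real.exp (Fintype.card ι * Real.binEntropy (m / Fintype.card ι)) * μ ^ m := by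
  set n := Fintype.card ι with hn
  rcases Nat.eq_zero_or_pos m with rfl | hm0
  · simp
  have hn0 : (0 : ℝ) < n := by exact_mod_cast (by omega : 0 < n)
  rcases hm.eq_or_lt with rfl | hmn
  · rw [div_self hn0.ne', Real.binEntropy_one, mul_zero, Real.exp_zero, one_mul]
    have : powersetCard n (univ : Finset ι) = {univ} := by
      rw [hn, ← card_univ, powersetCard_self]
    rw [this, sum_singleton]
    exact prod_le_average_pow c hc μ hμ
  have hμ0 : 0 ≤ μ := by
    have : 0 ≤ n * μ := hμ ▸ sum_nonneg fun i _ => hc i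
    exact (mul_nonneg_iff_of_pos_left hn0).1 this
  rcases hμ0.eq_or_lt with rfl | hμ0
  · have h0 : ∀ i, c i = 0 := fun i => by
      rw [mul_zero] at hμ
      exact (sum_eq_zero_iff_of_nonneg fun i _ => hc i).1 hμ i (mem_univ i)
    rw [sum_eq_zero, zero_pow hm0.ne', mul_zero]
    intro A hA
    obtain ⟨i, hi⟩ := card_pos.1 (by rw [(mem_powersetCard.1 hA).2]; exact hm0)
    exact prod_eq_zero hi (h0 i)
  have hmR : (0 : ℝ) < m := by exact_mod_cast hm0
  have hmn' : (m : ℝ) < n := by exact_mod_cast hmn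
  set a : ℝ := m / n with ha
  have ha0 : 0 < a := by positivity
  have ha1 : 0 < 1 - a := by rw [sub_pos, ha, div_lt_one hn0]; exact hmn'
  -- the optimal weight for the generating function `∏ (1 + lam * c i)`
  set lam : ℝ := a / ((1 - a) * μ) with hlam
  have hlam0 : 0 < lam := by positivity
  have h1 : lam ^ m * ∑ A ∈ powersetCard m (univ : Finset ι), ∏ i ∈ A, c i ≤
      ∏ i, (1 + lam * c i) := by
    rw [prod_one_add, mul_sum]
    refine (sum_le_sum_of_subset_of_nonneg (s := powersetCard m univ) (t := univ.powerset)
      (fun A _ => by simp) (f := fun A => ∏ i ∈ A, (lam * c i))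
      (fun A _ _ => prod_nonneg fun i _ => mul_nonneg hlam0.le (hc i))).trans' (le_of_eq ?_)
    refine sum_congr rfl fun A hA => ?_
    rw [prod_mul_distrib, prod_const, (mem_powersetCard.1 hA).2]
  have h2 : ∏ i, (1 + lam * c i) ≤ ((1 - a)⁻¹) ^ n := by
    refine prod_le_average_pow _ (fun i => ?_) _ ?_
    · have := mul_nonneg hlam0.le (hc i); linarith
    · rw [sum_add_distrib, ← mul_sum, hμ, hlam]
      simp only [sum_const, card_univ, nsmul_eq_mul, mul_one, ← hn]
      field_simp
      ring
  have hent : Real.exp (n * Real.binEntropy a) = (a⁻¹) ^ m * ((1 - a)⁻¹) ^ (n - m) := by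
    have e1 : (n : ℝ) * a = m := by rw [ha]; field_simp
    have e2 : (n : ℝ) * (1 - a) = (n - m : ℕ) := by
      rw [Nat.cast_sub hm]; linear_combination -e1
    rw [Real.binEntropy, mul_add, ← mul_assoc, ← mul_assoc, e1, e2, Real.exp_add,
      Real.exp_nat_mul, Real.exp_nat_mul, Real.exp_log (by positivity),
      Real.exp_log (by positivity)]
  have h3 := (h1.trans h2)
  rw [mul_comm, ← le_div_iff₀ (by positivity)] at h3
  refine h3.trans (le_of_eq ?_)
  obtain ⟨k, hk⟩ : ∃ k, n = m + k := ⟨n - m, by omega⟩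
  rw [hent, hk, Nat.add_sub_cancel_left, hlam, pow_add]
  simp only [div_pow, mul_pow, inv_pow]
  field_simp

end Analysis

/-! ### Partial matchings of a regular bipartite graph -/

section PartialMatchings

variable {α β : Type*}

open Classical in
/-- The partial matchings of size `m` of the bipartite graph of the relation `R`: sets of `m` pairs
in `R` on which both projections are injective. -/
noncomputable def partialMatchings [Fintype α] [Fintype β] (R : α → β → Prop) (m : ℕ) :
    Finset (Finset (α × β)) :=
  {F | (∀ p ∈ F, R p.1 p.2) ∧ Set.InjOn Prod.fst (F : Set (α × β)) ∧
    Set.InjOn Prod.snd (F : Set (α × β)) ∧ #F = m}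

variable [DecidableEq α] [DecidableEq β]

lemma card_perfMatchings_le {R : α → β → Prop} [DecidableRel R] {A : Finset α} {B : Finset β}
    {d : ℕ} (hB : ∀ a ∈ A, #{b ∈ B | R a b} ≤ d) :
    (#(perfMatchings R A B) : ℝ) ≤
      ∏ a ∈ A, (((#{b ∈ B | R a b} : ℕ) : ℝ) + shift d) / Real.exp 1 := by
  have hs := shift_nonneg d
  rcases (perfMatchings R A B).eq_empty_or_nonempty with h | h
  · rw [h]
    simp only [card_empty, Nat.cast_zero]
    exact prod_nonneg fun a _ => by positivity
  obtain ⟨F, hF⟩ := id h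
  obtain ⟨h1, h2, -⟩ := mem_perfMatchings.1 hF
  have hr : ∀ a ∈ A, 1 ≤ #{b ∈ B | R a b} := fun a ha => by
    obtain ⟨b, hb, -⟩ := h2 a ha
    exact card_pos.2 ⟨b, mem_filter.2 (h1 a b hb).2⟩
  have hpos : ∀ a ∈ A, 0 < (((#{b ∈ B | R a b} : ℕ) : ℝ) + shift d) / Real.exp 1 := fun a ha => by
    have : (1 : ℝ) ≤ (#{b ∈ B | R a b} : ℕ) := by exact_mod_cast hr a ha
    positivity
  refine (Real.log_le_log_iff (by exact_mod_cast h.card_pos) (prod_pos hpos)).1 ?_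
  rw [Real.log_prod fun a ha => (hpos a ha).ne']
  exact (log_card_perfMatchings_le R A B h).trans
    (sum_le_sum fun a ha => log_factorial_div_le (hr a ha) (hB a ha))

/-- The bound for bipartite graphs. For a fixed set `B` of matched vertices on the right, Bregman's
theorem and Maclaurin's inequality bound the sum over the sets `A` of matched vertices on the
left; the average of the degrees into `B` is `d * #B / n`. -/
theorem card_partialMatchings_le [Fintype α] (R : α → α → Prop) [DecidableRel R] {d : ℕ}
    (hrow : ∀ a, #{b | R a b} = d) (hcol : ∀ b, #{a | R a b} = d) {m : ℕ}
    (hm : m ≤ Fintype.card α) :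
    (#(partialMatchings R m) : ℝ) ≤
      Real.exp (Fintype.card α * Real.binEntropy (m / Fintype.card α)) ^ 2 *
        (((m : ℝ) / Fintype.card α * d + shift d) / Real.exp 1) ^ m := by
  rcases Nat.eq_zero_or_pos (Fintype.card α) with hn | hn
  · obtain rfl : m = 0 := by omega
    have : #(partialMatchings R 0) ≤ 1 := card_le_one.2 fun F hF G hG => by
      simp only [partialMatchings, mem_filter, card_eq_zero] at hF hG
      rw [hF.2.2.2.2, hG.2.2.2.2]
    simpa using (by exact_mod_cast this : (#(partialMatchings R 0) : ℝ) ≤ 1)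
  set n := Fintype.card α with hndef
  have hn0 : (0 : ℝ) < n := by exact_mod_cast hn
  set E := Real.exp (n * Real.binEntropy (m / n))
  set μ := ((m : ℝ) / n * d + shift d) / Real.exp 1 with hμ
  have hcover : partialMatchings R m ⊆ (powersetCard m univ).biUnion fun B =>
      (powersetCard m univ).biUnion fun A => perfMatchings R A B := by
    intro F hF
    simp only [partialMatchings, mem_filter, mem_univ, true_and] at hF
    obtain ⟨h1, h2, h3, h4⟩ := hF
    simp only [mem_biUnion, mem_powersetCard, subset_univ, true_and]
    refine ⟨F.image Prod.snd, by rw [card_image_of_injOn h3, h4], F.image Prod.fst,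
      by rw [card_image_of_injOn h2, h4], mem_perfMatchings.2 ⟨fun a b hab =>
        ⟨mem_image_of_mem Prod.fst hab, mem_image_of_mem Prod.snd hab, h1 _ hab⟩, ?_, ?_⟩⟩
    · intro a ha
      obtain ⟨p, hp, rfl⟩ := mem_image.1 ha
      exact ⟨p.2, hp, fun y hy => congrArg Prod.snd (h2 (mem_coe.2 hy) (mem_coe.2 hp) rfl)⟩
    · intro b hb
      obtain ⟨p, hp, rfl⟩ := mem_image.1 hb
      exact ⟨p.1, hp, fun y hy => congrArg Prod.fst (h3 (mem_coe.2 hy) (mem_coe.2 hp) rfl)⟩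
  have hB : ∀ B ∈ powersetCard m (univ : Finset α),
      ∑ A ∈ powersetCard m univ, (#(perfMatchings R A B) : ℝ) ≤ E * μ ^ m := by
    intro B hBm
    have hs := shift_nonneg d
    refine le_trans (sum_le_sum fun A _ => card_perfMatchings_le (d := d) fun a _ => ?_)
      (sum_powersetCard_prod_le (fun a => (((#{b ∈ B | R a b} : ℕ) : ℝ) + shift d) / Real.exp 1)
        (fun a => by positivity) μ ?_ m hm)
    · rw [← hrow a]
      exact card_le_card (filter_subset_filter _ (subset_univ _))
    · have hdc : ∑ a, #{b ∈ B | R a b} = m * d := by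
        have := sum_card_bipartiteAbove_eq_sum_card_bipartiteBelow (s := univ) (t := B) R
        simp only [bipartiteAbove, bipartiteBelow, hcol, sum_const, smul_eq_mul,
          (mem_powersetCard.1 hBm).2] at this
        exact this
      have hdc' : ∑ a, ((#{b ∈ B | R a b} : ℕ) : ℝ) = m * d := by exact_mod_cast hdc
      rw [← sum_div, sum_add_distrib, hdc', sum_const, card_univ, nsmul_eq_mul, ← hndef, hμ]
      field_simp
  have hbinom : (#(powersetCard m (univ : Finset α)) : ℝ) ≤ E := by
    have := sum_powersetCard_prod_le (fun _ : α => (1 : ℝ)) (fun _ => zero_le_one) 1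
      (by simp) m hm
    simpa using this
  have hμ0 : 0 ≤ μ := by have := shift_nonneg d; positivity
  calc (#(partialMatchings R m) : ℝ)
      ≤ ∑ B ∈ powersetCard m univ, ∑ A ∈ powersetCard m univ, (#(perfMatchings R A B) : ℝ) := by
        refine (Nat.cast_le.2 ((card_le_card hcover).trans (card_biUnion_le.trans
          (sum_le_sum fun B _ => card_biUnion_le)))).trans (le_of_eq ?_)
        push_cast; rfl
    _ ≤ ∑ B ∈ powersetCard m (univ : Finset α), E * μ ^ m := sum_le_sum hB
    _ = #(powersetCard m (univ : Finset α)) * (E * μ ^ m) := by rw [sum_const, nsmul_eq_mul]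
    _ ≤ E * (E * μ ^ m) := by gcongr
    _ = E ^ 2 * μ ^ m := by ring

end PartialMatchings

/-! ### Pairs of matchings and the bipartite double cover -/

section PairsOfMatchings

/-- Two fixed-point-free involutions of a set have a common proper 2-colouring. Neither of them can
preserve an orbit of their product, so each exchanges these orbits in pairs, and both pair them up
in the same way. -/
lemma exists_coloring_of_involutions {X : Type*} (σ₁ σ₂ : Equiv.Perm X)
    (h₁ : ∀ x, σ₁ (σ₁ x) = x) (h₂ : ∀ x, σ₂ (σ₂ x) = x) (f₁ : ∀ x, σ₁ x ≠ x)
    (f₂ : ∀ x, σ₂ x ≠ x) :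
    ∃ χ : X → Prop, (∀ x, χ (σ₁ x) ↔ ¬ χ x) ∧ ∀ x, χ (σ₂ x) ↔ ¬ χ x := by
  set τ := σ₁ * σ₂ with hτ
  have e₁ : σ₁ * σ₁ = 1 := Equiv.ext h₁
  have e₂ : σ₂ * σ₂ = 1 := Equiv.ext h₂
  have i₁ : σ₁⁻¹ = σ₁ := inv_eq_of_mul_eq_one_left e₁
  have i₂ : σ₂⁻¹ = σ₂ := inv_eq_of_mul_eq_one_left e₂
  have hinv : σ₁ * τ * σ₁⁻¹ = τ⁻¹ := by
    rw [hτ, mul_inv_rev, i₁, i₂, ← mul_assoc, e₁, one_mul]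
  have hconj : ∀ (k : ℤ) (x : X), σ₁ ((τ ^ k) x) = (τ ^ (-k)) (σ₁ x) := by
    intro k x
    have : σ₁ * τ ^ k = τ ^ (-k) * σ₁ := by
      rw [zpow_neg, ← inv_zpow, ← hinv, conj_zpow, inv_mul_cancel_right]
    exact congrArg (· x) this
  have hne : ∀ x, ¬ τ.SameCycle x (σ₁ x) := by
    rintro x ⟨k, hk⟩
    obtain ⟨j, rfl | rfl⟩ := Int.even_or_odd' k
    · apply f₁ ((τ ^ j) x)
      rw [hconj, ← hk, ← Equiv.Perm.mul_apply, ← zpow_add]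
      congr 2; ring
    · apply f₂ ((τ ^ j) x)
      apply σ₁.injective
      change τ ((τ ^ j) x) = _
      rw [hconj, ← hk, ← Equiv.Perm.mul_apply, ← Equiv.Perm.mul_apply, ← zpow_add, ← zpow_one_add]
      congr 2; ring
  let s := Equiv.Perm.SameCycle.setoid τ
  let f : Quotient s → Quotient s := Quotient.map σ₁ (by
    rintro x y ⟨k, rfl⟩
    exact ⟨-k, (hconj k x).symm⟩)
  have hf : ∀ x : X, f ⟦x⟧ = ⟦σ₁ x⟧ := fun x => rfl
  have hff : ∀ x : X, f ⟦σ₁ x⟧ = ⟦x⟧ := fun x => by rw [hf, h₁]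
  have h₂' : ∀ x : X, (⟦σ₂ x⟧ : Quotient s) = ⟦σ₁ x⟧ := fun x => by
    have : σ₂ x = σ₁ (τ x) := by rw [hτ, Equiv.Perm.mul_apply, h₁]
    rw [this, ← hf, ← hf]
    congr 1
    exact Quotient.sound ⟨-1, by simp⟩
  have hflip : ∀ x : X, WellOrderingRel (⟦σ₁ x⟧ : Quotient s) (f ⟦σ₁ x⟧) ↔
      ¬ WellOrderingRel (⟦x⟧ : Quotient s) (f ⟦x⟧) := by
    intro x
    rw [hff, hf]
    have hneq : (⟦x⟧ : Quotient s) ≠ ⟦σ₁ x⟧ := fun h => hne x (Quotient.exact h)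
    constructor
    · exact fun h h' => asymm h h'
    · intro h
      rcases trichotomous_of WellOrderingRel (⟦x⟧ : Quotient s) ⟦σ₁ x⟧ with h' | h' | h'
      · exact absurd h' h
      · exact absurd h' hneq
      · exact h'
  exact ⟨fun x => WellOrderingRel (⟦x⟧ : Quotient s) (f ⟦x⟧), hflip, fun x => by
    simp only [h₂']; exact hflip x⟩

variable {V : Type*} {G : SimpleGraph V}

/-- A matching as a fixed-point-free involution: take two copies of the vertex set, match both
copies of the covered vertices, and exchange the two copies of each uncovered vertex. -/
lemma exists_involution_of_isMatching {M : G.Subgraph} (hM : M.IsMatching) :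
    ∃ σ : Equiv.Perm (V × Bool), (∀ x, σ (σ x) = x) ∧ (∀ x, σ x ≠ x) ∧
      ∀ u v i, M.Adj u v → σ (u, i) = (v, i) := by
  classical
  let p : V × Bool → V × Bool := fun x =>
    if h : ∃ w, M.Adj x.1 w then (h.choose, x.2) else (x.1, !x.2)
  have hp : ∀ u v i, M.Adj u v → p (u, i) = (v, i) := by
    intro u v i huv
    have h : ∃ w, M.Adj (u, i).1 w := ⟨v, huv⟩
    simp only [p, dif_pos h]
    rw [hM.eq_of_adj_left huv h.choose_spec]
  have hp' : ∀ u i, (¬ ∃ w, M.Adj u w) → p (u, i) = (u, !i) := by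
    intro u i h
    simp only [p, dif_neg h]
  have hpp : Function.Involutive p := by
    rintro ⟨u, i⟩
    by_cases h : ∃ w, M.Adj u w
    · obtain ⟨w, hw⟩ := h
      rw [hp u w i hw, hp w u i hw.symm]
    · rw [hp' u i h, hp' u _ h, Bool.not_not]
  refine ⟨hpp.toPerm p, hpp, ?_, hp⟩
  rintro ⟨u, i⟩ hx
  change p (u, i) = (u, i) at hx
  by_cases h : ∃ w, M.Adj u w
  · obtain ⟨w, hw⟩ := h
    rw [hp u w i hw] at hx
    exact hw.ne (congrArg Prod.fst hx).symm
  · rw [hp' u i h] at hx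
    simpa using congrArg Prod.snd hx

/-- `χ` is a proper 2-colouring of the graph with adjacency relation `r`. -/
def IsProperColoring (r : V → V → Prop) (χ : V → Prop) : Prop :=
  ∀ u v, r u v → (χ v ↔ ¬ χ u)

open Classical in
/-- A proper 2-colouring of `r` that depends on `r` only (an arbitrary set if there is none). -/
noncomputable def someColoring (r : V → V → Prop) : V → Prop :=
  if h : ∃ χ, IsProperColoring r χ then h.choose else fun _ => True

lemma isProperColoring_someColoring {M₁ M₂ : G.Subgraph} (h₁ : M₁.IsMatching)
    (h₂ : M₂.IsMatching) :
    IsProperColoring (M₁ ⊔ M₂).Adj (someColoring (M₁ ⊔ M₂).Adj) := by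
  have h : ∃ χ, IsProperColoring (M₁ ⊔ M₂).Adj χ := by
    obtain ⟨σ₁, i₁, f₁, a₁⟩ := exists_involution_of_isMatching h₁
    obtain ⟨σ₂, i₂, f₂, a₂⟩ := exists_involution_of_isMatching h₂
    obtain ⟨χ, c₁, c₂⟩ := exists_coloring_of_involutions σ₁ σ₂ i₁ i₂ f₁ f₂
    refine ⟨fun v => χ (v, true), fun u v huv => ?_⟩
    beta_reduce
    rcases SimpleGraph.Subgraph.sup_adj.1 huv with h | h
    · rw [← a₁ u v true h, c₁]
    · rw [← a₂ u v true h, c₂]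
  rw [someColoring, dif_pos h]
  exact h.choose_spec

lemma isMatching_ext {M M' : G.Subgraph} (h : M.IsMatching) (h' : M'.IsMatching)
    (hadj : ∀ u v, M.Adj u v ↔ M'.Adj u v) : M = M' := by
  refine SimpleGraph.Subgraph.IsMatching.injOn_edgeSet h h' ?_
  ext e
  induction e with
  | _ u v => exact hadj u v

section Finite

variable [Fintype V]

open Classical in
/-- The edges of `M` that have exactly one endpoint in `χ`, oriented away from `χ`. -/
noncomputable def arcsFrom (M : G.Subgraph) (χ : V → Prop) : Finset (V × V) :=
  {p | M.Adj p.1 p.2 ∧ χ p.1 ∧ ¬ χ p.2}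

lemma mem_arcsFrom {M : G.Subgraph} {χ : V → Prop} {u v : V} :
    (u, v) ∈ arcsFrom M χ ↔ M.Adj u v ∧ χ u ∧ ¬ χ v := by
  simp [arcsFrom]

lemma card_arcsFrom {M : G.Subgraph} {χ : V → Prop} (hχ : IsProperColoring M.Adj χ) :
    #(arcsFrom M χ) = M.edgeSet.ncard := by
  have himg : M.edgeSet = (fun p : V × V => s(p.1, p.2)) '' (arcsFrom M χ : Set (V × V)) := by
    ext e
    induction e with
    | _ u v =>
      simp only [SimpleGraph.Subgraph.mem_edgeSet, Set.mem_image, mem_coe, Prod.exists,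
        mem_arcsFrom]
      constructor
      · intro h
        have hc := hχ u v h
        by_cases hu : χ u
        · exact ⟨u, v, ⟨h, hu, fun hv => hc.1 hv hu⟩, rfl⟩
        · exact ⟨v, u, ⟨h.symm, hc.2 hu, hu⟩, Sym2.eq_swap⟩
      · rintro ⟨a, b, ⟨h, -, -⟩, hab⟩
        rw [← SimpleGraph.Subgraph.mem_edgeSet, ← hab]
        exact h
  rw [himg, Set.InjOn.ncard_image, Set.ncard_coe_finset]
  rintro ⟨a, b⟩ hab ⟨a', b'⟩ hab' h
  rw [mem_coe, mem_arcsFrom] at hab hab'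
  rcases Sym2.eq_iff.1 h with ⟨h1, h2⟩ | ⟨h1, h2⟩
  · exact Prod.ext h1 h2
  · simp only at h1 h2
    exact absurd (h1 ▸ hab.2.1) hab'.2.2

open Classical in
/-- The union of two matchings with its 2-colouring turned into a set of arcs: the edges of `M₁`
are directed from the first colour class to the second, those of `M₂` backwards. -/
noncomputable def orientedUnion (M₁ M₂ : G.Subgraph) : Finset (V × V) :=
  arcsFrom M₁ (someColoring (M₁ ⊔ M₂).Adj) ∪ arcsFrom M₂ (fun v => ¬ someColoring (M₁ ⊔ M₂).Adj v)

lemma mem_orientedUnion {M₁ M₂ : G.Subgraph} (h₁ : M₁.IsMatching) (h₂ : M₂.IsMatching) {u v : V} :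
    (u, v) ∈ orientedUnion M₁ M₂ ↔ (M₁.Adj u v ∧ someColoring (M₁ ⊔ M₂).Adj u) ∨
      (M₂.Adj u v ∧ ¬ someColoring (M₁ ⊔ M₂).Adj u) := by
  have hχ := isProperColoring_someColoring h₁ h₂ u v
  rw [SimpleGraph.Subgraph.sup_adj] at hχ
  simp only [orientedUnion, mem_union, mem_arcsFrom]
  tauto

lemma orientedUnion_mem_partialMatchings {M₁ M₂ : G.Subgraph} (h₁ : M₁.IsMatching)
    (h₂ : M₂.IsMatching) : orientedUnion M₁ M₂ ∈
      partialMatchings G.Adj (M₁.edgeSet.ncard + M₂.edgeSet.ncard) := by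
  classical
  have hχ := isProperColoring_someColoring h₁ h₂
  have hmem := fun u v => mem_orientedUnion h₁ h₂ (u := u) (v := v)
  simp only [partialMatchings, mem_filter, mem_univ, true_and]
  have hχ₁ : IsProperColoring M₁.Adj (someColoring (M₁ ⊔ M₂).Adj) :=
    fun u v h => hχ u v (Or.inl h)
  have hχ₂ : IsProperColoring M₂.Adj (someColoring (M₁ ⊔ M₂).Adj) :=
    fun u v h => hχ u v (Or.inr h)
  refine ⟨?_, ?_, ?_, ?_⟩
  · rintro ⟨u, v⟩ h
    rcases (hmem u v).1 h with h | h
    · exact h.1.adj_sub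
    · exact h.1.adj_sub
  · rintro ⟨u, v⟩ h ⟨u', v'⟩ h' (rfl : u = u')
    rw [mem_coe, hmem] at h h'
    refine Prod.ext rfl ?_
    rcases h with h | h <;> rcases h' with h' | h'
    · exact h₁.eq_of_adj_left h.1 h'.1
    · exact absurd h.2 h'.2
    · exact absurd h'.2 h.2
    · exact h₂.eq_of_adj_left h.1 h'.1
  · rintro ⟨u, v⟩ h ⟨u', v'⟩ h' (rfl : v = v')
    rw [mem_coe, hmem] at h h'
    refine Prod.ext ?_ rfl
    rcases h with h | h <;> rcases h' with h' | h'
    · exact h₁.eq_of_adj_right h.1 h'.1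
    · exact absurd h.2 (by have := hχ₁ u v h.1; have := hχ₂ u' v h'.1; tauto)
    · exact absurd h'.2 (by have := hχ₁ u' v h'.1; have := hχ₂ u v h.1; tauto)
    · exact h₂.eq_of_adj_right h.1 h'.1
  · rw [orientedUnion, card_union_of_disjoint, card_arcsFrom hχ₁, card_arcsFrom]
    · intro u v h
      have := hχ₂ u v h
      tauto
    · rw [disjoint_left]
      rintro ⟨u, v⟩ h h'
      exact (mem_arcsFrom.1 h').2.1 (mem_arcsFrom.1 h).2.1

/-- A pair of matchings can be recovered from its oriented union: forgetting the directions gives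
the union of the two matchings, hence the colouring, and the colouring tells which edge is which. -/
lemma orientedUnion_injective {M₁ M₂ M₁' M₂' : G.Subgraph} (h₁ : M₁.IsMatching)
    (h₂ : M₂.IsMatching) (h₁' : M₁'.IsMatching) (h₂' : M₂'.IsMatching)
    (h : orientedUnion M₁ M₂ = orientedUnion M₁' M₂') : M₁ = M₁' ∧ M₂ = M₂' := by
  have hunion : ∀ {M₁ M₂ : G.Subgraph}, M₁.IsMatching → M₂.IsMatching → ∀ u v,
      (M₁ ⊔ M₂).Adj u v ↔ (u, v) ∈ orientedUnion M₁ M₂ ∨ (v, u) ∈ orientedUnion M₁ M₂ := by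
    intro M₁ M₂ h₁ h₂ u v
    have hχ := isProperColoring_someColoring h₁ h₂ u v
    rw [mem_orientedUnion h₁ h₂, mem_orientedUnion h₁ h₂, M₁.adj_comm v, M₂.adj_comm v]
    rw [SimpleGraph.Subgraph.sup_adj] at hχ ⊢
    tauto
  have hadj : (M₁ ⊔ M₂).Adj = (M₁' ⊔ M₂').Adj := by
    funext u v
    rw [eq_iff_iff, hunion h₁ h₂, hunion h₁' h₂', h]
  have hfst : ∀ {M₁ M₂ : G.Subgraph}, M₁.IsMatching → M₂.IsMatching → ∀ u v,
      (M₁.Adj u v ↔ ((u, v) ∈ orientedUnion M₁ M₂ ∧ someColoring (M₁ ⊔ M₂).Adj u) ∨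
        ((v, u) ∈ orientedUnion M₁ M₂ ∧ someColoring (M₁ ⊔ M₂).Adj v)) ∧
      (M₂.Adj u v ↔ ((u, v) ∈ orientedUnion M₁ M₂ ∧ ¬ someColoring (M₁ ⊔ M₂).Adj u) ∨
        ((v, u) ∈ orientedUnion M₁ M₂ ∧ ¬ someColoring (M₁ ⊔ M₂).Adj v)) := by
    intro M₁ M₂ h₁ h₂ u v
    have hχ := isProperColoring_someColoring h₁ h₂ u v
    rw [mem_orientedUnion h₁ h₂, mem_orientedUnion h₁ h₂, M₁.adj_comm v, M₂.adj_comm v]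
    rw [SimpleGraph.Subgraph.sup_adj] at hχ
    tauto
  refine ⟨isMatching_ext h₁ h₁' fun u v => ?_, isMatching_ext h₂ h₂' fun u v => ?_⟩
  · rw [(hfst h₁ h₂ u v).1, (hfst h₁' h₂' u v).1, h, hadj]
  · rw [(hfst h₁ h₂ u v).2, (hfst h₁' h₂' u v).2, h, hadj]

/-- Pairs of matchings of size `ℓ` of `G` inject into the matchings of size `2 ℓ` of its bipartite
double cover. -/
lemma numMatchings_sq_le (G : SimpleGraph V) (ℓ : ℕ) :
    numMatchings G ℓ ^ 2 ≤ #(partialMatchings G.Adj (2 * ℓ)) := by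
  set S : Set G.Subgraph := {M : G.Subgraph | M.IsMatching ∧ M.edgeSet.ncard = ℓ} with hS
  have hprod : numMatchings G ℓ ^ 2 = (S ×ˢ S).ncard := by
    rw [Set.ncard_prod, sq]; rfl
  rw [hprod, ← Set.ncard_coe_finset]
  refine Set.ncard_le_ncard_of_injOn (fun P => orientedUnion P.1 P.2) ?_ ?_ (Set.toFinite _)
  · rintro ⟨M₁, M₂⟩ ⟨⟨h₁, c₁⟩, h₂, c₂⟩
    have := orientedUnion_mem_partialMatchings h₁ h₂
    rwa [c₁, c₂, ← two_mul] at this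
  · rintro ⟨M₁, M₂⟩ ⟨⟨h₁, -⟩, h₂, -⟩ ⟨M₁', M₂'⟩ ⟨⟨h₁', -⟩, h₂', -⟩ h
    have := orientedUnion_injective h₁ h₂ h₁' h₂' h
    exact Prod.ext this.1 this.2

end Finite

end PairsOfMatchings

/-! ### The upper bound for regular graphs -/

section UpperBound

lemma H_mul_log_two (p : ℝ) : H p * Real.log 2 = Real.binEntropy p := by
  have h2 : Real.log 2 ≠ 0 := (Real.log_pos one_lt_two).ne'
  rw [H, Real.binEntropy, Real.logb, Real.logb, Real.log_inv, Real.log_inv]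
  field_simp
  ring

lemma logQuot_mul_log_two (d : ℕ) : logQuot d * Real.log 2 = lnQuot d := by
  have h2 : Real.log 2 ≠ 0 := (Real.log_pos one_lt_two).ne'
  rw [logQuot, lnQuot]
  split_ifs with h
  · rw [Real.logb, Real.log_exp, div_mul_cancel₀ _ h2]
  · rw [Real.logb]
    field_simp

/-- The bound, in natural logarithms. -/
lemma matchingBound_mul_log_two (d N ℓ : ℕ) :
    matchingBound d N ℓ * Real.log 2 = (N : ℝ) / 2 *
      (coverFraction N ℓ * Real.log d + 2 * Real.binEntropy (coverFraction N ℓ)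
        + coverFraction N ℓ * (Real.log (coverFraction N ℓ) - 1) + lnQuot d) := by
  have h2 : Real.log 2 ≠ 0 := (Real.log_pos one_lt_two).ne'
  have h3 : coverFraction N ℓ * Real.logb 2 (coverFraction N ℓ / Real.exp 1) * Real.log 2 =
      coverFraction N ℓ * (Real.log (coverFraction N ℓ) - 1) := by
    rcases eq_or_ne (coverFraction N ℓ) 0 with h | h
    · simp [h]
    · rw [Real.logb, Real.log_div h (Real.exp_pos 1).ne', Real.log_exp]
      field_simp
  have h4 : coverFraction N ℓ * Real.logb 2 d * Real.log 2 = coverFraction N ℓ * Real.log d := by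
    rw [Real.logb]
    field_simp
  rw [matchingBound, ← H_mul_log_two, ← logQuot_mul_log_two, ← h3, ← h4]
  ring

/-- Passing from `a d + shift d` to `a d` costs at most `lnQuot d`, by Bernoulli's inequality. -/
lemma mul_log_add_shift_le {d : ℕ} (hd : 1 ≤ d) {a : ℝ} (ha0 : 0 < a) (ha1 : a ≤ 1) :
    a * Real.log (a * d + shift d) ≤ a * Real.log d + a * Real.log a + lnQuot d := by
  have hd0 : (0 : ℝ) < d := by exact_mod_cast hd
  have hx : 0 ≤ Real.exp (lnQuot d) - 1 := sub_nonneg.2 (Real.one_le_exp (lnQuot_nonneg d))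
  have e : a * d + shift d = d * a * (1 + (Real.exp (lnQuot d) - 1) / a) := by
    rw [shift]; field_simp
  have hpos : 0 < 1 + (Real.exp (lnQuot d) - 1) / a := by positivity
  rw [e, Real.log_mul (by positivity) hpos.ne', Real.log_mul hd0.ne' ha0.ne']
  have hB := rpow_one_add_le_one_add_mul_self (s := (Real.exp (lnQuot d) - 1) / a)
    (by have : 0 ≤ (Real.exp (lnQuot d) - 1) / a := by positivity
        linarith) ha0.le ha1
  rw [mul_div_cancel₀ _ ha0.ne', add_sub_cancel] at hB
  have := Real.log_le_log (by positivity) hB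
  rw [Real.log_rpow hpos, Real.log_exp] at this
  linarith

theorem logb_numMatchings_le {V : Type*} [Fintype V] (G : SimpleGraph V) [G.LocallyFinite]
    (d ℓ : ℕ) (hd : 1 ≤ d) (hreg : G.IsRegularOfDegree d) (hℓ : 2 * ℓ ≤ Fintype.card V)
    (hne : numMatchings G ℓ ≠ 0) :
    Real.logb 2 (numMatchings G ℓ : ℝ) ≤ matchingBound d (Fintype.card V) ℓ := by
  classical
  have hlog2 := Real.log_pos one_lt_two
  rw [Real.logb, div_le_iff₀ hlog2, matchingBound_mul_log_two]
  set N := Fintype.card V with hN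
  have hrow : ∀ a, #{b | G.Adj a b} = d := fun a => by
    rw [← hreg a, ← G.card_neighborFinset_eq_degree]
    congr 1
    ext b
    simp
  have hcol : ∀ b, #{a | G.Adj a b} = d := fun b => by
    simp_rw [← hrow b, G.adj_comm]
  have hα : ((2 * ℓ : ℕ) : ℝ) / N = coverFraction N ℓ := by
    rw [coverFraction]; push_cast; rfl
  have hmain := card_partialMatchings_le G.Adj hrow hcol hℓ
  rw [← hN, hα] at hmain
  have hsq : ((numMatchings G ℓ : ℝ)) ^ 2 ≤ #(partialMatchings G.Adj (2 * ℓ)) := by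
    exact_mod_cast numMatchings_sq_le G ℓ
  replace hmain := hsq.trans hmain
  set a := coverFraction N ℓ with ha
  have hΦ : (0 : ℝ) < numMatchings G ℓ := by exact_mod_cast Nat.pos_of_ne_zero hne
  rcases Nat.eq_zero_or_pos ℓ with rfl | hℓ0
  · have ha0 : a = 0 := by rw [ha, coverFraction]; simp
    have h1 : (numMatchings G 0 : ℝ) ≤ 1 := by
      have : (numMatchings G 0 : ℝ) ^ 2 ≤ 1 := by simpa [ha0] using hmain
      nlinarith
    have h2 := Real.log_nonpos hΦ.le h1
    have h3 := lnQuot_nonneg d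
    rw [ha0]
    simp only [zero_mul, Real.binEntropy_zero, mul_zero, zero_add]
    exact h2.trans (by positivity)
  · have hN0 : (0 : ℝ) < N := by exact_mod_cast (by omega : 0 < N)
    have hℓR : (0 : ℝ) < ℓ := by exact_mod_cast hℓ0
    have ha0 : 0 < a := by rw [ha, coverFraction]; positivity
    have ha1 : a ≤ 1 := by
      rw [ha, coverFraction, div_le_one hN0]; exact_mod_cast hℓ
    have hNa : N * a = 2 * ℓ := by rw [ha, coverFraction]; field_simp
    have hd0 : (0 : ℝ) < d := by exact_mod_cast hd
    have hs := shift_nonneg d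
    have hpos : 0 < a * d + shift d := by positivity
    have hl := Real.log_le_log (by positivity) hmain
    rw [Real.log_mul (by positivity) (by positivity), Real.log_pow, Real.log_pow, Real.log_pow,
      Real.log_exp, Real.log_div hpos.ne' (Real.exp_pos 1).ne', Real.log_exp] at hl
    push_cast at hl
    have hb := mul_le_mul_of_nonneg_left (mul_log_add_shift_le hd ha0 ha1) hN0.le
    rw [← mul_assoc, hNa] at hb
    have : N * (a * (Real.log a - 1)) = N * (a * Real.log a) - 2 * ℓ := by
      rw [← hNa]; ring
    linarith

end UpperBound

/-! ### Matchings of disjoint unions of complete bipartite graphs -/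

section DisjointUnion

variable {t d : ℕ}

/-- The subgraph of `t K_{d,d}` that has, in the `i`-th copy, the edges between the pairs related by
`r i`, and no isolated vertices. -/
def blockSubgraph (r : Fin t → Fin d → Fin d → Prop) : (copiesKdd t d).Subgraph where
  Adj u v := ∃ i a b, r i a b ∧
    ((u = (i, Sum.inl a) ∧ v = (i, Sum.inr b)) ∨ (u = (i, Sum.inr b) ∧ v = (i, Sum.inl a)))
  verts := {u | ∃ v, ∃ i a b, r i a b ∧
    ((u = (i, Sum.inl a) ∧ v = (i, Sum.inr b)) ∨ (u = (i, Sum.inr b) ∧ v = (i, Sum.inl a)))}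
  adj_sub := by
    rintro u v ⟨i, a, b, -, ⟨rfl, rfl⟩ | ⟨rfl, rfl⟩⟩ <;> simp [copiesKdd]
  edge_vert := fun h => ⟨_, h⟩
  symm := ⟨by
    rintro u v ⟨i, a, b, h, ⟨rfl, rfl⟩ | ⟨rfl, rfl⟩⟩
    · exact ⟨i, a, b, h, Or.inr ⟨rfl, rfl⟩⟩
    · exact ⟨i, a, b, h, Or.inl ⟨rfl, rfl⟩⟩⟩

lemma blockSubgraph_adj (r : Fin t → Fin d → Fin d → Prop) (i : Fin t) (a b : Fin d) :
    (blockSubgraph r).Adj (i, Sum.inl a) (i, Sum.inr b) ↔ r i a b := by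
  simp [blockSubgraph]

lemma blockSubgraph_isMatching {r : Fin t → Fin d → Fin d → Prop}
    (hr : ∀ i a b b', r i a b → r i a b' → b = b') (hr' : ∀ i a a' b, r i a b → r i a' b → a = a') :
    (blockSubgraph r).IsMatching := by
  rintro u ⟨v, i, a, b, h, ⟨rfl, rfl⟩ | ⟨rfl, rfl⟩⟩
  · refine ⟨_, ⟨i, a, b, h, Or.inl ⟨rfl, rfl⟩⟩, ?_⟩
    rintro w ⟨j, a', b', h', ⟨h1, rfl⟩ | ⟨h1, rfl⟩⟩
    · simp only [Prod.mk.injEq, Sum.inl.injEq] at h1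
      obtain ⟨rfl, rfl⟩ := h1
      rw [hr _ _ _ _ h h']
    · simp at h1
  · refine ⟨_, ⟨i, a, b, h, Or.inr ⟨rfl, rfl⟩⟩, ?_⟩
    rintro w ⟨j, a', b', h', ⟨h1, rfl⟩ | ⟨h1, rfl⟩⟩
    · simp at h1
    · simp only [Prod.mk.injEq, Sum.inr.injEq] at h1
      obtain ⟨rfl, rfl⟩ := h1
      rw [hr' _ _ _ _ h h']

lemma ncard_edgeSet_blockSubgraph (r : Fin t → Fin d → Fin d → Prop) :
    (blockSubgraph r).edgeSet.ncard = {p : Fin t × Fin d × Fin d | r p.1 p.2.1 p.2.2}.ncard := by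
  have himg : (blockSubgraph r).edgeSet =
      (fun p : Fin t × Fin d × Fin d => s((p.1, Sum.inl p.2.1), (p.1, Sum.inr p.2.2))) ''
        {p : Fin t × Fin d × Fin d | r p.1 p.2.1 p.2.2} := by
    ext e
    induction e with
    | _ u v =>
      rw [SimpleGraph.Subgraph.mem_edgeSet]
      constructor
      · rintro ⟨i, a, b, h, ⟨rfl, rfl⟩ | ⟨rfl, rfl⟩⟩
        · exact ⟨(i, a, b), h, rfl⟩
        · exact ⟨(i, a, b), h, Sym2.eq_swap⟩
      · rintro ⟨⟨i, a, b⟩, h, hab⟩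
        rw [← SimpleGraph.Subgraph.mem_edgeSet, ← hab]
        exact (blockSubgraph_adj r i a b).2 h
  rw [himg, Set.InjOn.ncard_image]
  rintro ⟨i, a, b⟩ - ⟨i', a', b'⟩ - h
  simp only [Sym2.eq_iff, Prod.mk.injEq, Sum.inl.injEq, Sum.inr.injEq, reduceCtorEq, and_false,
    or_false] at h
  obtain ⟨⟨rfl, rfl⟩, -, rfl⟩ := h
  rfl

/-- The number of matchings of size `k` of `K_{d,d}`. -/
def numMatchingsKdd (d k : ℕ) : ℕ := d.choose k * d.descFactorial k

/-- Choosing matchings in the copies of `K_{d,d}` independently gives distinct matchings of the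
union. -/
lemma prod_numMatchingsKdd_le (k : Fin t → ℕ) :
    ∏ i, numMatchingsKdd d (k i) ≤ numMatchings (copiesKdd t d) (∑ i, k i) := by
  let X := (i : Fin t) → (A : powersetCard (k i) (univ : Finset (Fin d))) × (A.1 ↪ Fin d)
  have hX : Nat.card X = ∏ i, numMatchingsKdd d (k i) := by
    rw [Nat.card_pi]
    refine prod_congr rfl fun i _ => ?_
    rw [Nat.card_eq_fintype_card, Fintype.card_sigma, sum_congr rfl (g := fun _ =>
      d.descFactorial (k i)) fun A _ => ?_]
    · simp [numMatchingsKdd]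
    · rw [Fintype.card_embedding_eq, Fintype.card_fin, Fintype.card_coe,
        (mem_powersetCard.1 A.2).2]
  let r : X → Fin t → Fin d → Fin d → Prop := fun x i a b => ∃ h : a ∈ (x i).1.1, (x i).2 ⟨a, h⟩ = b
  have hmem : ∀ x : X, blockSubgraph (r x) ∈ {M : (copiesKdd t d).Subgraph |
      M.IsMatching ∧ M.edgeSet.ncard = ∑ i, k i} := by
    intro x
    refine ⟨blockSubgraph_isMatching ?_ ?_, ?_⟩
    · rintro i a b b' ⟨h, rfl⟩ ⟨h', rfl⟩
      rfl
    · rintro i a a' b ⟨h, rfl⟩ ⟨h', h''⟩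
      exact (congrArg Subtype.val ((x i).2.injective h'')).symm
    · rw [ncard_edgeSet_blockSubgraph]
      let g : ((i : Fin t) × (x i).1.1) → Fin t × Fin d × Fin d :=
        fun q => (q.1, q.2.1, (x q.1).2 q.2)
      have hg : Function.Injective g := by
        rintro ⟨i, a⟩ ⟨i', a'⟩ h
        simp only [g, Prod.mk.injEq] at h
        obtain ⟨rfl, h1, -⟩ := h
        rw [Subtype.ext h1]
      have hrange : {p : Fin t × Fin d × Fin d | r x p.1 p.2.1 p.2.2} = Set.range g := by
        ext ⟨i, a, b⟩
        constructor
        · rintro ⟨h, h'⟩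
          exact ⟨⟨i, a, h⟩, congrArg (fun c => (i, a, c)) h'⟩
        · rintro ⟨⟨i', a'⟩, h⟩
          simp only [g, Prod.mk.injEq] at h
          obtain ⟨rfl, rfl, rfl⟩ := h
          exact ⟨a'.2, rfl⟩
      rw [hrange, ← Nat.card_coe_set_eq, Nat.card_range_of_injective hg,
        Nat.card_eq_fintype_card, Fintype.card_sigma]
      refine sum_congr rfl fun i _ => ?_
      rw [Fintype.card_coe, (mem_powersetCard.1 (x i).1.2).2]
  rw [← hX, numMatchings, ← Nat.card_coe_set_eq]
  refine Nat.card_le_card_of_injective (fun x => ⟨blockSubgraph (r x), hmem x⟩) ?_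
  intro x y hxy
  have hsub : blockSubgraph (r x) = blockSubgraph (r y) := congrArg Subtype.val hxy
  have hr : ∀ i a b, r x i a b ↔ r y i a b := fun i a b => by
    rw [← blockSubgraph_adj (r x), ← blockSubgraph_adj (r y), hsub]
  funext i
  have hA : (x i).1 = (y i).1 := by
    apply Subtype.ext
    ext a
    exact ⟨fun h => ((hr i a _).1 ⟨h, rfl⟩).1, fun h => ((hr i a _).2 ⟨h, rfl⟩).1⟩
  have hf : ∀ a h h', (x i).2 ⟨a, h⟩ = (y i).2 ⟨a, h'⟩ := fun a h h' =>
    ((hr i a _).1 ⟨h, rfl⟩).2.symm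
  revert hA hf
  generalize x i = p
  generalize y i = q
  obtain ⟨A, f⟩ := p
  obtain ⟨B, g⟩ := q
  rintro (rfl : A = B) hf
  congr 1
  ext a
  exact congrArg Fin.val (hf a.1 a.2 a.2)

lemma numMatchingsKdd_pos {k : ℕ} (hk : k ≤ d) : 0 < numMatchingsKdd d k :=
  Nat.mul_pos (Nat.choose_pos hk) (Nat.pos_of_ne_zero fun h => by
    rw [Nat.descFactorial_eq_zero_iff_lt] at h; omega)

/-- The quotient of consecutive terms is `(d - k) ^ 2 / (k + 1)`. -/
lemma numMatchingsKdd_le_mul_succ {k : ℕ} (hk : k < d) :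
    numMatchingsKdd d k ≤ d * numMatchingsKdd d (k + 1) := by
  have h1 := Nat.choose_succ_right_eq d k
  have h2 := Nat.descFactorial_succ d k
  have hdk : 1 ≤ d - k := by omega
  calc numMatchingsKdd d k = d.choose k * d.descFactorial k * 1 := by simp [numMatchingsKdd]
    _ ≤ d.choose k * d.descFactorial k * ((d - k) * (d - k)) :=
      Nat.mul_le_mul_left _ (Nat.mul_le_mul hdk hdk)
    _ = (d.choose k * (d - k)) * ((d - k) * d.descFactorial k) := by ring
    _ = (k + 1) * numMatchingsKdd d (k + 1) := by rw [← h1, ← h2, numMatchingsKdd]; ring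
    _ ≤ d * numMatchingsKdd d (k + 1) := Nat.mul_le_mul_right _ hk

/-- Distributing `ℓ` edges as evenly as possible over the `t` copies. -/
lemma numMatchingsKdd_pow_le (hd : 1 ≤ d) (ht : 0 < t) {ℓ : ℕ} (hℓ : ℓ ≤ d * t) :
    numMatchingsKdd d (ℓ / t) ^ t ≤ d ^ t * numMatchings (copiesKdd t d) ℓ := by
  set k := ℓ / t with hk
  set j := ℓ % t with hj
  have hdiv : t * k + j = ℓ := Nat.div_add_mod ℓ t
  let f : Fin t → ℕ := fun i => if (i : ℕ) < j then k + 1 else k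
  have hsum : ∑ i, f i = ℓ := by
    have hcount : #{i : Fin t | (i : ℕ) < j} = j := by
      rw [Fin.card_filter_val_lt, min_eq_right (Nat.mod_lt ℓ ht).le]
    have : ∀ i, f i = k + if (i : ℕ) < j then 1 else 0 := fun i => by
      simp only [f]; split_ifs <;> rfl
    simp_rw [this]
    rw [sum_add_distrib, sum_const, card_univ, Fintype.card_fin, smul_eq_mul,
      ← card_filter, hcount, hdiv]
  calc numMatchingsKdd d k ^ t = ∏ _i : Fin t, numMatchingsKdd d k := by simp
    _ ≤ ∏ i, d * numMatchingsKdd d (f i) := by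
      refine prod_le_prod' fun i _ => ?_
      simp only [f]
      split_ifs with hi
      · refine numMatchingsKdd_le_mul_succ ?_
        by_contra hcon
        have : t * d ≤ t * k := Nat.mul_le_mul_left _ (by omega)
        have := Nat.mul_comm t d
        omega
      · exact Nat.le_mul_of_pos_left _ hd
    _ = d ^ t * ∏ i, numMatchingsKdd d (f i) := by rw [prod_mul_distrib]; simp
    _ ≤ d ^ t * numMatchings (copiesKdd t d) ℓ := by
      refine Nat.mul_le_mul_left _ ?_
      rw [← hsum]
      exact prod_numMatchingsKdd_le f

end DisjointUnion

/-! ### Comparison of the bound with `t K_{d,d}` -/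

section Asymptotics

/-- The loss of `1` is needed for `m = 0` only, where `x log x` may be negative. -/
lemma mul_log_sub_one_le {m : ℕ} {x : ℝ} (hx : (m : ℝ) ≤ x) :
    m * Real.log m - 1 ≤ x * Real.log x := by
  rcases Nat.eq_zero_or_pos m with rfl | hm
  · rw [Nat.cast_zero] at hx
    rcases hx.eq_or_lt with rfl | hx
    · simp
    · have := Real.one_sub_inv_le_log_of_pos hx
      have := mul_le_mul_of_nonneg_left this hx.le
      rw [mul_sub, mul_inv_cancel₀ hx.ne'] at this
      simp only [Nat.cast_zero, zero_mul]
      linarith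
  · have hm1 : (1 : ℝ) ≤ m := by exact_mod_cast hm
    have := mul_le_mul hx (Real.log_le_log (by linarith) hx) (Real.log_nonneg hm1) (by linarith)
    linarith

lemma mul_log_sub_le_log_factorial (n : ℕ) : n * Real.log n - n ≤ Real.log n.factorial := by
  rcases Nat.eq_zero_or_pos n with rfl | hn
  · simp
  have hn0 : (0 : ℝ) < n := by exact_mod_cast hn
  have hf : (0 : ℝ) < n.factorial := by exact_mod_cast n.factorial_pos
  have := Real.log_le_log (by positivity) (Real.pow_div_factorial_le_exp (n : ℝ) hn0.le n)
  rw [Real.log_div (by positivity) hf.ne', Real.log_pow, Real.log_exp] at this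
  linarith

lemma log_factorial_le_of_le {m d : ℕ} (hd : 1 ≤ d) (hm : m ≤ d) :
    Real.log m.factorial ≤ m * Real.log m - m + 1 + Real.log d := by
  have hd1 : (1 : ℝ) ≤ d := by exact_mod_cast hd
  have hlogd := Real.log_nonneg hd1
  rcases Nat.eq_zero_or_pos m with rfl | hm0
  · simp; linarith
  have hm1 : (1 : ℝ) ≤ m := by exact_mod_cast hm0
  have h1 := log_factorial_le m hm0
  have h2 := Real.log_le_log (by linarith) (by exact_mod_cast hm : (m : ℝ) ≤ d)
  have h3 := Real.log_nonneg hm1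
  linarith

lemma log_numMatchingsKdd {d k : ℕ} (hk : k ≤ d) : Real.log (numMatchingsKdd d k) =
    2 * Real.log d.factorial - Real.log k.factorial - 2 * Real.log (d - k).factorial := by
  have hf : ∀ n : ℕ, (n.factorial : ℝ) ≠ 0 := fun n => by exact_mod_cast n.factorial_ne_zero
  have hc : (d.choose k : ℝ) ≠ 0 := by exact_mod_cast (Nat.choose_pos hk).ne'
  have hdf : (d.descFactorial k : ℝ) ≠ 0 := by
    rw [Ne, Nat.cast_eq_zero, Nat.descFactorial_eq_zero_iff_lt]
    omega
  have h1 : (d.choose k : ℝ) * k.factorial * (d - k).factorial = d.factorial := by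
    exact_mod_cast Nat.choose_mul_factorial_mul_factorial hk
  have h2 : ((d - k).factorial : ℝ) * d.descFactorial k = d.factorial := by
    exact_mod_cast Nat.factorial_mul_descFactorial hk
  have l1 := congrArg Real.log h1
  have l2 := congrArg Real.log h2
  rw [Real.log_mul (mul_ne_zero hc (hf k)) (hf _), Real.log_mul hc (hf k)] at l1
  rw [Real.log_mul (hf _) hdf] at l2
  rw [numMatchingsKdd, Nat.cast_mul, Real.log_mul hc hdf]
  linarith

/-- The main term of the bound for one copy of `K_{d,d}`, evaluated at a possibly fractional number
`x` of edges, against the number of matchings with `⌊x⌋` edges. -/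
lemma mainTerm_le_log_numMatchingsKdd {d k : ℕ} (hd : 1 ≤ d) {x : ℝ} (hkx : (k : ℝ) ≤ x)
    (hxk : x ≤ k + 1) (hxd : x ≤ d) :
    (d : ℝ) * (x / d * Real.log d + 2 * Real.binEntropy (x / d) + x / d * (Real.log (x / d) - 1)) ≤
      Real.log (numMatchingsKdd d k) + (8 + 5 * Real.log d) := by
  have hd0 : (0 : ℝ) < d := by exact_mod_cast hd
  have hk : k ≤ d := by exact_mod_cast hkx.trans hxd
  have hx0 : 0 ≤ x := (Nat.cast_nonneg k).trans hkx
  have e1 : x * Real.log (x / d) = x * Real.log x - x * Real.log d := by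
    rcases hx0.eq_or_lt with rfl | hx
    · simp
    · rw [Real.log_div hx.ne' hd0.ne']; ring
  have e2 : (d - x) * Real.log (1 - x / d) =
      (d - x) * Real.log (d - x) - (d - x) * Real.log d := by
    rcases hxd.eq_or_lt with rfl | hx
    · simp
    · rw [one_sub_div hd0.ne', Real.log_div (sub_pos.2 hx).ne' hd0.ne']; ring
  have e3 : (d : ℝ) * (x / d * Real.log d + 2 * Real.binEntropy (x / d) +
      x / d * (Real.log (x / d) - 1)) =
      2 * d * Real.log d - x * Real.log x - 2 * ((d - x) * Real.log (d - x)) - x := by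
    have : (d : ℝ) * (x / d * Real.log d + 2 * Real.binEntropy (x / d) +
      x / d * (Real.log (x / d) - 1)) = x * Real.log d - 2 * (x * Real.log (x / d)) -
        2 * ((d - x) * Real.log (1 - x / d)) + x * Real.log (x / d) - x := by
      rw [Real.binEntropy, Real.log_inv, Real.log_inv]
      field_simp
      ring
    rw [this, e1, e2]
    ring
  -- truncated subtraction: `m = 0` covers both `k = d - 1` and `k = d`
  obtain ⟨m, hm⟩ : ∃ m, m = d - (k + 1) := ⟨_, rfl⟩
  have hmd : (m : ℝ) ≤ d - x := by
    rcases Nat.eq_zero_or_pos m with h | h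
    · rw [h, Nat.cast_zero]; linarith
    · have : (m : ℝ) + (k + 1) = d := by exact_mod_cast (by omega : m + (k + 1) = d)
      linarith
  have hm2 : (d : ℝ) ≤ m + k + 1 := by exact_mod_cast (by omega : d ≤ m + k + 1)
  have hfac : Real.log (d - k).factorial ≤ Real.log d + Real.log m.factorial := by
    rw [← Real.log_mul hd0.ne' (by exact_mod_cast m.factorial_ne_zero)]
    refine Real.log_le_log (by exact_mod_cast Nat.factorial_pos _) ?_
    norm_cast
    rcases hk.eq_or_lt with rfl | hk
    · rw [Nat.sub_self, Nat.factorial_zero]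
      exact Nat.one_le_iff_ne_zero.2 (mul_ne_zero (by omega) m.factorial_ne_zero)
    · rw [show d - k = m + 1 by omega, Nat.factorial_succ]
      exact Nat.mul_le_mul_right _ (by omega)
  have h1 := mul_log_sub_one_le hkx
  have h2 := mul_log_sub_one_le hmd
  have h3 := mul_log_sub_le_log_factorial d
  have h4 := log_factorial_le_of_le hd hk
  have h5 := log_factorial_le_of_le hd (by omega : m ≤ d)
  rw [e3, log_numMatchingsKdd hk]
  linarith

lemma mul_lnQuot_le {d : ℕ} (hd : 1 ≤ d) : d * lnQuot d ≤ 1 + 2 * Real.log d := by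
  have hd1 : (1 : ℝ) ≤ d := by exact_mod_cast hd
  have hlogd := Real.log_nonneg hd1
  rw [lnQuot]
  split_ifs with h
  · rw [h]; simp
  · have hd2 : (2 : ℝ) ≤ d := by exact_mod_cast (by omega : 2 ≤ d)
    rw [← mul_div_assoc, div_le_iff₀ (by linarith)]
    nlinarith

theorem rpow_matchingBound_le {d t ℓ N : ℕ} (hd : 1 ≤ d) (hN : N = 2 * d * t) (hℓ : 2 * ℓ ≤ N) :
    (2 : ℝ) ^ matchingBound d N ℓ ≤ Real.exp ((9 + 8 * Real.log d) / (2 * d) * N) *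
      (numMatchings (copiesKdd t d) ℓ : ℝ) := by
  rcases Nat.eq_zero_or_pos t with rfl | ht
  · obtain rfl : N = 0 := by simpa using hN
    obtain rfl : ℓ = 0 := by omega
    have := prod_numMatchingsKdd_le (t := 0) (d := d) (fun _ => 0)
    simp only [univ_eq_empty, prod_empty, sum_empty] at this
    simpa [matchingBound] using this
  have hd0 : (0 : ℝ) < d := by exact_mod_cast hd
  have ht0 : (0 : ℝ) < t := by exact_mod_cast ht
  have hℓ' : ℓ ≤ d * t := by
    have : 2 * d * t = 2 * (d * t) := by ring
    omega
  set k := ℓ / t with hk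
  have hkd : k ≤ d := Nat.div_le_of_le_mul (by rw [mul_comm]; exact hℓ')
  have hmain := numMatchingsKdd_pow_le hd ht hℓ'
  have hKpos := numMatchingsKdd_pos hkd
  have hΦ : 0 < numMatchings (copiesKdd t d) ℓ := by
    refine Nat.pos_of_ne_zero fun h => ?_
    rw [h, mul_zero] at hmain
    exact absurd hmain (not_le.2 (pow_pos hKpos t))
  have hΦR : (0 : ℝ) < numMatchings (copiesKdd t d) ℓ := by exact_mod_cast hΦ
  have hKR : (0 : ℝ) < numMatchingsKdd d k := by exact_mod_cast hKpos
  have hmainR : (numMatchingsKdd d k : ℝ) ^ t ≤ (d : ℝ) ^ t * numMatchings (copiesKdd t d) ℓ := by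
    exact_mod_cast hmain
  have hl := Real.log_le_log (by positivity) hmainR
  rw [Real.log_mul (by positivity) hΦR.ne', Real.log_pow, Real.log_pow] at hl
  have hx : coverFraction N ℓ = ((ℓ : ℝ) / t) / d := by
    rw [coverFraction, hN]; push_cast; field_simp
  have hNR : (N : ℝ) = 2 * d * t := by rw [hN]; push_cast; ring
  have hterm := mainTerm_le_log_numMatchingsKdd (k := k) (x := (ℓ : ℝ) / t) hd
    (by rw [le_div_iff₀ ht0]; exact_mod_cast Nat.div_mul_le_self ℓ t)
    (by rw [div_le_iff₀ ht0]; exact_mod_cast (Nat.lt_mul_of_div_lt (Nat.lt_succ_self k) ht).le)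
    (by rw [div_le_iff₀ ht0]; exact_mod_cast hℓ')
  rw [← hx] at hterm
  have hq := mul_lnQuot_le hd
  rw [Real.rpow_def_of_pos two_pos, mul_comm (Real.log 2), matchingBound_mul_log_two,
    ← Real.exp_log hΦR, ← Real.exp_add, Real.exp_le_exp]
  have hε : (9 + 8 * Real.log d) / (2 * d) * N = t * (9 + 8 * Real.log d) := by
    rw [hNR]; field_simp
  rw [hε, hNR]
  have hadd := mul_le_mul_of_nonneg_left (add_le_add hterm hq) ht0.le
  linarith

lemma tendsto_errorTerm :
    Filter.Tendsto (fun d : ℕ => (9 + 8 * Real.log d) / (2 * d)) Filter.atTop (nhds 0) := by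
  have h1 : Filter.Tendsto (fun d : ℕ => Real.log d / d) Filter.atTop (nhds 0) :=
    Real.isLittleO_log_id_atTop.tendsto_div_nhds_zero.comp tendsto_natCast_atTop_atTop
  have h2 : Filter.Tendsto (fun d : ℕ => (9 / 2 : ℝ) / d) Filter.atTop (nhds 0) :=
    tendsto_const_div_atTop_nhds_zero_nat _
  have h3 := h2.add (h1.const_mul 4)
  rw [mul_zero, add_zero] at h3
  refine h3.congr fun d => ?_
  rw [div_div, ← mul_div_assoc]
  rcases eq_or_ne (d : ℝ) 0 with h | h
  · simp [h]
  · field_simp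
    ring

end Asymptotics

end UpperMatching

theorem theorem1 :
    (∀ (V : Type*) [Fintype V] (G : SimpleGraph V) [G.LocallyFinite] (d ℓ : ℕ),
      1 ≤ d → G.IsRegularOfDegree d → 2 * ℓ ≤ Fintype.card V →
      UpperMatching.numMatchings G ℓ ≠ 0 →
      Real.logb 2 (UpperMatching.numMatchings G ℓ : ℝ) ≤
        UpperMatching.matchingBound d (Fintype.card V) ℓ) ∧
    (∃ ε : ℕ → ℝ, Filter.Tendsto ε Filter.atTop (nhds 0) ∧
      ∀ d t ℓ N : ℕ, 1 ≤ d → N = 2 * d * t → 2 * ℓ ≤ N →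
        (2 : ℝ) ^ UpperMatching.matchingBound d N ℓ ≤
          Real.exp (ε d * (N : ℝ)) *
            (UpperMatching.numMatchings (UpperMatching.copiesKdd t d) ℓ : ℝ)) :=
  ⟨fun _ _ G _ d ℓ hd hreg hℓ hne => UpperMatching.logb_numMatchings_le G d ℓ hd hreg hℓ hne,
    fun d => (9 + 8 * Real.log d) / (2 * d), UpperMatching.tendsto_errorTerm,
    fun _ _ _ _ hd hN hℓ => UpperMatching.rpow_matchingBound_le hd hN hℓ⟩
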